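/- Let $\mathbb K$ be $\mathbb R$ or $\mathbb C$. For a nonzero matrix $A\in\mathbb K^{m\times n}$ write $\|A\|_2$ and $\|A\|_F$ for the spectral and Frobenius norms, $A^\dagger$ for the Moore–Penrose pseudoinverse, $r=\|A\|_F^2/\|A\|_2^2$ for the stable rank, and $\kappa(A)=\|A\|_2\|A^\dagger\|_2$. There are universal constants $C,c>0$ such that the following holds. Let $S_1,\dots,S_\ell$ be linear subspaces of $\mathbb K^m$ that are independent, i.e. $\dim(\sum_i S_i)=\sum_i\dim S_i$, and let $d_{\max}=\max_i\dim S_i$. Let $A\in\mathbb K^{m\times n}$ be a nonzero matrix whose columns $a_1,\dots,a_n$ all lie in $\bigcup_i S_i$. Assume that for each $i$ the data $\{a_1,\dots,a_n\}\cap S_i$ are generic (any $\dim S_i$ distinct points among them are linearly independent) and that, if $\dim S_i\ge 2$, they consist of more than $\dim S_i$ distinct points. Let $\delta\in(0,1)$, $0<\varepsilon<\kappa(A)^{-1}$, and let $d_1\in\{1,\dots,m\}$, $d_2\in\{1,\dots,n\}$ satisfy \[ d_1,d_2\ \ge\ C\,\frac{r}{\varepsilon^4\delta}\log\Big(\frac{r}{\varepsilon^4\delta}\Big).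 \] Draw $d_1$ row indices $I$ independently with replacement, row $i$ having probability $\|A(i,:)\|_2^2/\|A\|_F^2$, and, independently of these, $d_2$ column indices $J$ independently with replacement, column $j$ having probability $\|A(:,j)\|_2^2/\|A\|_F^2$. Put $C_J=A(:,J)$, $R=A(I,:)$, $U=A(I,J)$, $Y=U^\dagger R$, and $Q=|Y^*Y|$ (entrywise absolute values). Then with probability at least $(1-2e^{-c/\delta})^2$, \[ A=C_JU^\dagger R, \] and $Q^{d_{\max}}$ is a clustering matrix for $A$: for all $p,q$, $(Q^{d_{\max}})_{p,q}\neq 0$ if and only if $a_p$ and $a_q$ lie in a common $S_i$. On the same event both conclusions also hold when $I$ and $J$ are replaced by the same indices without repetitions. -/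

import Mathlib

open MeasureTheory
open scoped Matrix

namespace SubspaceCUR

/-! ### The Moore–Penrose pseudoinverse -/

/-- `X` satisfies the four Penrose equations for `A`. -/
structure IsMoorePenrose {𝕜 : Type*} [RCLike 𝕜] {α β : Type*} [Fintype α] [Fintype β]
    (A : Matrix α β 𝕜) (X : Matrix β α 𝕜) : Prop where
  mul_mul_self : A * X * A = A
  self_mul_mul : X * A * X = X
  isHermitian_left : (A * X).IsHermitian
  isHermitian_right : (X * A).IsHermitian

open ComplexOrder in
/-- Every matrix has a Moore–Penrose pseudoinverse. -/
theorem exists_isMoorePenrose {𝕜 : Type*} [RCLike 𝕜] {α β : Type*} [Fintype α] [Fintype β]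
    (A : Matrix α β 𝕜) : ∃ X : Matrix β α 𝕜, IsMoorePenrose A X := by
  classical
  have hH : (Aᴴ * A).IsHermitian := Matrix.isHermitian_conjTranspose_mul_self A
  obtain ⟨P, hP, h1, h2, h3⟩ : ∃ P : Matrix β β 𝕜, P.IsHermitian ∧
      (Aᴴ * A) * P * (Aᴴ * A) = Aᴴ * A ∧ P * (Aᴴ * A) * P = P ∧
      (P * (Aᴴ * A)).IsHermitian := by
    generalize Aᴴ * A = H at hH
    set V : Matrix β β 𝕜 := (hH.eigenvectorUnitary : Matrix β β 𝕜) with hV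
    set D : Matrix β β 𝕜 := Matrix.diagonal (fun i => (hH.eigenvalues i : 𝕜)) with hD
    set E : Matrix β β 𝕜 := Matrix.diagonal (fun i => (hH.eigenvalues i : 𝕜)⁻¹) with hE
    have hVV : Vᴴ * V = 1 := by
      have := Unitary.coe_star_mul_self hH.eigenvectorUnitary
      simpa [Matrix.star_eq_conjTranspose] using this
    have hs : H = V * D * Vᴴ := by
      have := hH.spectral_theorem
      rw [Unitary.conjStarAlgAut_apply] at this
      exact this
    have key : ∀ X Y : Matrix β β 𝕜, (V * X * Vᴴ) * (V * Y * Vᴴ) = V * (X * Y) * Vᴴ := by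
      intro X Y
      calc (V * X * Vᴴ) * (V * Y * Vᴴ) = V * X * (Vᴴ * V) * Y * Vᴴ := by
            simp only [Matrix.mul_assoc]
        _ = V * (X * Y) * Vᴴ := by rw [hVV]; simp only [Matrix.mul_assoc, Matrix.one_mul]
    have herm : ∀ X : Matrix β β 𝕜, X.IsHermitian → (V * X * Vᴴ).IsHermitian := fun X hX =>
      Matrix.isHermitian_mul_mul_conjTranspose V hX
    have hEh : E.IsHermitian := by
      rw [hE]
      refine Matrix.isHermitian_diagonal_of_self_adjoint _ ?_
      ext i
      simp
    have hDE : (E * D).IsHermitian := by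
      rw [hE, hD, Matrix.diagonal_mul_diagonal]
      refine Matrix.isHermitian_diagonal_of_self_adjoint _ ?_
      ext i
      simp
    refine ⟨V * E * Vᴴ, herm E hEh, ?_, ?_, ?_⟩
    · rw [hs, key, key]
      congr 2
      rw [hE, hD, Matrix.diagonal_mul_diagonal, Matrix.diagonal_mul_diagonal]
      congr 1
      ext i
      exact mul_inv_mul_cancel _
    · rw [hs, key, key]
      congr 2
      rw [hE, hD, Matrix.diagonal_mul_diagonal, Matrix.diagonal_mul_diagonal]
      congr 1
      ext i
      by_cases h : (hH.eigenvalues i : 𝕜) = 0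
      · simp [h]
      · field_simp
    · rw [hs, key]
      exact herm _ hDE
  have h4 : A * (P * (Aᴴ * A)) = A := by
    have h0 : A * (P * (Aᴴ * A) - 1) = 0 := by
      rw [← Matrix.conjTranspose_mul_self_eq_zero, Matrix.conjTranspose_mul, Matrix.mul_assoc,
        ← Matrix.mul_assoc Aᴴ, Matrix.mul_sub, ← Matrix.mul_assoc (Aᴴ * A), h1, Matrix.mul_one,
        sub_self, Matrix.mul_zero]
    rw [Matrix.mul_sub, Matrix.mul_one] at h0
    exact sub_eq_zero.mp h0
  refine ⟨P * Aᴴ, ⟨?_, ?_, ?_, ?_⟩⟩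
  · simpa only [Matrix.mul_assoc] using h4
  · calc P * Aᴴ * A * (P * Aᴴ) = P * (Aᴴ * A) * P * Aᴴ := by simp only [Matrix.mul_assoc]
      _ = P * Aᴴ := by rw [h2]
  · rw [← Matrix.mul_assoc]
    exact Matrix.isHermitian_mul_mul_conjTranspose A hP
  · rw [Matrix.mul_assoc]
    exact h3

/-- The pseudoinverse is unique. -/
theorem IsMoorePenrose.unique {𝕜 : Type*} [RCLike 𝕜] {α β : Type*} [Fintype α] [Fintype β]
    {A : Matrix α β 𝕜} {X Y : Matrix β α 𝕜} (hX : IsMoorePenrose A X)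
    (hY : IsMoorePenrose A Y) : X = Y := by
  have hl : A * X = A * Y := by
    have e : A * X = A * Y * (A * X) := by rw [← Matrix.mul_assoc, hY.mul_mul_self]
    have e' : (A * Y * (A * X))ᴴ = A * X * (A * Y) := by
      rw [Matrix.conjTranspose_mul, hX.isHermitian_left.eq, hY.isHermitian_left.eq]
    rw [← hX.isHermitian_left.eq, e, e', ← Matrix.mul_assoc, hX.mul_mul_self]
  have hr : X * A = Y * A := by
    have e : X * A = X * A * (Y * A) := by
      rw [Matrix.mul_assoc, ← Matrix.mul_assoc A, hY.mul_mul_self]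
    have e' : (X * A * (Y * A))ᴴ = Y * A * (X * A) := by
      rw [Matrix.conjTranspose_mul, hX.isHermitian_right.eq, hY.isHermitian_right.eq]
    rw [← hX.isHermitian_right.eq, e, e', Matrix.mul_assoc, ← Matrix.mul_assoc A,
      hX.mul_mul_self]
  rw [← hX.self_mul_mul, hr, Matrix.mul_assoc, hl, ← Matrix.mul_assoc, hY.self_mul_mul]

/-- The Moore–Penrose pseudoinverse `A†`: the unique solution of the four Penrose equations. -/
noncomputable def pinv {𝕜 : Type*} [RCLike 𝕜] {α β : Type*} [Fintype α] [Fintype β]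
    (A : Matrix α β 𝕜) : Matrix β α 𝕜 :=
  Classical.choose (exists_isMoorePenrose A)

theorem isMoorePenrose_pinv {𝕜 : Type*} [RCLike 𝕜] {α β : Type*} [Fintype α] [Fintype β]
    (A : Matrix α β 𝕜) : IsMoorePenrose A (pinv A) :=
  Classical.choose_spec (exists_isMoorePenrose A)

/-! ### Norms, stable rank, condition number -/

/-- The spectral norm `‖A‖₂`: the operator norm between Euclidean spaces. -/
noncomputable def specNorm {𝕜 : Type*} [RCLike 𝕜] {m n : ℕ}
    (A : Matrix (Fin m) (Fin n) 𝕜) : ℝ :=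
  ‖(Matrix.toEuclideanLin A).toContinuousLinearMap‖

/-- The squared Frobenius norm `‖A‖_F²`. -/
noncomputable def frobSq {𝕜 : Type*} [RCLike 𝕜] {m n : ℕ}
    (A : Matrix (Fin m) (Fin n) 𝕜) : ℝ :=
  ∑ i, ∑ j, ‖A i j‖ ^ 2

/-- The stable rank `‖A‖_F² / ‖A‖₂²`. -/
noncomputable def stableRank {𝕜 : Type*} [RCLike 𝕜] {m n : ℕ}
    (A : Matrix (Fin m) (Fin n) 𝕜) : ℝ :=
  frobSq A / specNorm A ^ 2

/-- The generalized spectral condition number `κ(A) = ‖A‖₂ ‖A†‖₂`. -/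
noncomputable def condNumber {𝕜 : Type*} [RCLike 𝕜] {m n : ℕ}
    (A : Matrix (Fin m) (Fin n) 𝕜) : ℝ :=
  specNorm A * specNorm (pinv A)

/-! ### Length-squared sampling -/

/-- Row probabilities `q_i = ‖A(i,:)‖₂² / ‖A‖_F²`. -/
noncomputable def rowProb {𝕜 : Type*} [RCLike 𝕜] {m n : ℕ}
    (A : Matrix (Fin m) (Fin n) 𝕜) (i : Fin m) : ℝ :=
  (∑ j, ‖A i j‖ ^ 2) / frobSq A

/-- Column probabilities `p_j = ‖A(:,j)‖₂² / ‖A‖_F²`. -/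
noncomputable def colProb {𝕜 : Type*} [RCLike 𝕜] {m n : ℕ}
    (A : Matrix (Fin m) (Fin n) 𝕜) (j : Fin n) : ℝ :=
  (∑ i, ‖A i j‖ ^ 2) / frobSq A

/-- The measure on `Fin N` giving the point `i` the mass `w i`. -/
noncomputable def weightMeasure {N : ℕ} (w : Fin N → ℝ) : Measure (Fin N) :=
  ∑ i, ENNReal.ofReal (w i) • Measure.dirac i

/-- The joint law of `d₁` row indices drawn independently with replacement with probabilities
`rowProb A` and, independently of them, `d₂` column indices drawn independently with replacement
with probabilities `colProb A`. -/
noncomputable def samplingLaw {𝕜 : Type*} [RCLike 𝕜] {m n : ℕ}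
    (A : Matrix (Fin m) (Fin n) 𝕜) (d₁ d₂ : ℕ) :
    Measure ((Fin d₁ → Fin m) × (Fin d₂ → Fin n)) :=
  (Measure.pi fun _ : Fin d₁ => weightMeasure (rowProb A)).prod
    (Measure.pi fun _ : Fin d₂ => weightMeasure (colProb A))

instance isFiniteMeasure_weightMeasure {N : ℕ} (w : Fin N → ℝ) :
    IsFiniteMeasure (weightMeasure w) := by
  refine ⟨?_⟩
  simp [weightMeasure]

theorem weightMeasure_univ {N : ℕ} (w : Fin N → ℝ) (h0 : ∀ i, 0 ≤ w i) (h1 : ∑ i, w i = 1) :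
    IsProbabilityMeasure (weightMeasure w) := by
  refine ⟨?_⟩
  simp [weightMeasure, ← ENNReal.ofReal_sum_of_nonneg (fun i _ => h0 i), h1]

/-- For a nonzero matrix the sampling law is a probability measure. -/
theorem isProbabilityMeasure_samplingLaw {𝕜 : Type*} [RCLike 𝕜] {m n : ℕ}
    (A : Matrix (Fin m) (Fin n) 𝕜) (hA : A ≠ 0) (d₁ d₂ : ℕ) :
    IsProbabilityMeasure (samplingLaw A d₁ d₂) := by
  have hn : 0 ≤ frobSq A := by unfold frobSq; positivity
  have hF : frobSq A ≠ 0 := by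
    intro h
    apply hA
    ext i j
    have h1 := (Finset.sum_eq_zero_iff_of_nonneg
      (fun i _ => Finset.sum_nonneg fun j _ => by positivity)).mp h i (Finset.mem_univ i)
    have h2 := (Finset.sum_eq_zero_iff_of_nonneg
      (fun j _ => by positivity)).mp h1 j (Finset.mem_univ j)
    simpa using h2
  have hr : IsProbabilityMeasure (weightMeasure (rowProb A)) := by
    refine weightMeasure_univ _ (fun i => by unfold rowProb; positivity) ?_
    simp only [rowProb]
    rw [← Finset.sum_div]
    exact div_self hF
  have hc : IsProbabilityMeasure (weightMeasure (colProb A)) := by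
    refine weightMeasure_univ _ (fun i => by unfold colProb; positivity) ?_
    simp only [colProb]
    rw [← Finset.sum_div, Finset.sum_comm]
    exact div_self hF
  unfold samplingLaw
  infer_instance

/-! ### Subspace data -/

/-- The data points (columns of `A`) lying in the subspace `S`, as a set of vectors. -/
def dataIn {𝕜 : Type*} [RCLike 𝕜] {m n : ℕ} (A : Matrix (Fin m) (Fin n) 𝕜)
    (S : Submodule 𝕜 (Fin m → 𝕜)) : Set (Fin m → 𝕜) :=
  {v | v ∈ S ∧ ∃ j, A.col j = v}

/-- A collection `B` of points in a subspace `S` is generic if any `dim S` points of `B` are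
linearly independent. -/
def IsGeneric {𝕜 : Type*} [RCLike 𝕜] {m : ℕ} (S : Submodule 𝕜 (Fin m → 𝕜))
    (B : Set (Fin m → 𝕜)) : Prop :=
  ∀ T : Finset (Fin m → 𝕜), (T : Set (Fin m → 𝕜)) ⊆ B → T.card = Module.finrank 𝕜 S →
    LinearIndepOn 𝕜 id (T : Set (Fin m → 𝕜))

/-- Independence of a finite family of subspaces: `dim (∑ Sᵢ) = ∑ dim Sᵢ`. -/
def IndependentSubspaces {𝕜 : Type*} [RCLike 𝕜] {m l : ℕ}
    (S : Fin l → Submodule 𝕜 (Fin m → 𝕜)) : Prop :=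
  Module.finrank 𝕜 (⨆ i, S i : Submodule 𝕜 (Fin m → 𝕜)) = ∑ i, Module.finrank 𝕜 (S i)

/-- The maximal dimension of the subspaces. -/
noncomputable def maxDim {𝕜 : Type*} [RCLike 𝕜] {m l : ℕ}
    (S : Fin l → Submodule 𝕜 (Fin m → 𝕜)) : ℕ :=
  Finset.univ.sup fun i => Module.finrank 𝕜 (S i)

/-- `W` is a clustering matrix: `W p q ≠ 0` exactly if the columns `p` and `q` of `A` lie in a
common subspace. -/
def IsClusteringMatrix {𝕜 : Type*} [RCLike 𝕜] {m n l : ℕ} (A : Matrix (Fin m) (Fin n) 𝕜)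
    (S : Fin l → Submodule 𝕜 (Fin m → 𝕜)) (W : Matrix (Fin n) (Fin n) ℝ) : Prop :=
  ∀ p q, W p q ≠ 0 ↔ ∃ i, A.col p ∈ S i ∧ A.col q ∈ S i

/-! ### CUR factors for the row indices `I` and the column indices `J` -/

/-- `Y = U† R` with `U = A(I,J)` and `R = A(I,:)`. -/
noncomputable def curY {𝕜 : Type*} [RCLike 𝕜] {m n : ℕ} {α β : Type*} [Fintype α] [Fintype β]
    (A : Matrix (Fin m) (Fin n) 𝕜) (I : α → Fin m) (J : β → Fin n) : Matrix β (Fin n) 𝕜 :=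
  pinv (A.submatrix I J) * A.submatrix I id

/-- `Q = |Y^* Y|` (entrywise absolute value). -/
noncomputable def curQ {𝕜 : Type*} [RCLike 𝕜] {m n : ℕ} {α β : Type*} [Fintype α] [Fintype β]
    (A : Matrix (Fin m) (Fin n) 𝕜) (I : α → Fin m) (J : β → Fin n) :
    Matrix (Fin n) (Fin n) ℝ :=
  ((curY A I J)ᴴ * curY A I J).map fun x => ‖x‖

/-- The conclusion for index lists `I`, `J`: `A = C U† R` with `C = A(:,J)`, and `Q ^ d_max` is a
clustering matrix for `A`. -/
def CURClusters {𝕜 : Type*} [RCLike 𝕜] {m n l : ℕ} {α β : Type*} [Fintype α] [Fintype β]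
    (A : Matrix (Fin m) (Fin n) 𝕜) (S : Fin l → Submodule 𝕜 (Fin m → 𝕜))
    (I : α → Fin m) (J : β → Fin n) : Prop :=
  A = A.submatrix id J * pinv (A.submatrix I J) * A.submatrix I id ∧
    IsClusteringMatrix A S (curQ A I J ^ maxDim S)

end SubspaceCUR

namespace SubspaceCUR

/-! ### Spanning by random samples -/

/-! The argument splits into a deterministic and a probabilistic half. Deterministic: suppose the
sampled columns `C` span the column space and the sampled rows `R` span the row space. Then `C = W
U` and `R = U X`, so `C U† R = A` (`eq_cols_mul_curY`). The matrix `U†U` is the orthogonal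
projection with kernel `ker U = ker C`. Independence of the subspaces makes `ker C` invariant under
the coordinate projections onto blocks, so `U†U` commutes with them and `Y` is block-supported
(`curY_eq_zero_of_ne`). Hence `Q` has no entries between blocks. Inside a block, a set of generic
vectors larger than the dimension cannot split into two mutually orthogonal parts, so spans of
neighbourhoods in the non-orthogonality graph grow at each step until full
(`pow_apply_ne_zero_of_generic`). Probabilistic: if `V` lies in the column space, the length-squared
weight outside `V` is at least its codimension times `μ = 1 / (‖A†‖₂² ‖A‖_F²)`, which is `1 / (r
κ²)`. The expected codimension of the sampled span therefore contracts by `1 - μ` per draw, and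
Markov's inequality bounds the failure probability by `k (1 - μ) ^ d`, where `k` is the rank. Rows
are treated as columns of `Aᴴ`. -/

/-- Given the current span `V`, a new draw leaves `V` with probability at least `(k - dim V) μ`, and
then the dimension rises. So the expected codimension shrinks by the factor `1 - μ` at each draw. -/
theorem sum_prod_mul_codim_le {K E : Type*} [Field K] [AddCommGroup E] [Module K E]
    [FiniteDimensional K E] {n : ℕ} (a : Fin n → E) (w : Fin n → ℝ) (hw : ∀ j, 0 ≤ w j)
    (hw1 : ∑ j, w j = 1) (k : ℕ) {μ : ℝ} (hμ : μ ≤ 1)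
    (h : ∀ V : Submodule K E, V ≤ Submodule.span K (Set.range a) →
      ((k : ℝ) - Module.finrank K V) * μ ≤ ∑ j, open Classical in if a j ∈ V then 0 else w j)
    (d : ℕ) :
    ∑ x : Fin d → Fin n, (∏ i, w (x i)) *
      ((k : ℝ) - Module.finrank K (Submodule.span K (Set.range (a ∘ x)))) ≤ k * (1 - μ) ^ d := by
  classical
  induction d with
  | zero => simp
  | succ d ih =>
    rw [← (Fin.consEquiv fun _ => Fin n).sum_comp, Fintype.sum_prod_type_right]
    have step : ∀ x : Fin d → Fin n, ∑ j, (∏ i, w ((Fin.cons j x : Fin (d + 1) → Fin n) i)) *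
        ((k : ℝ) - Module.finrank K
          (Submodule.span K (Set.range (a ∘ (Fin.cons j x : Fin (d + 1) → Fin n))))) ≤
        (1 - μ) * ((∏ i, w (x i)) *
          ((k : ℝ) - Module.finrank K (Submodule.span K (Set.range (a ∘ x))))) := by
      intro x
      set V := Submodule.span K (Set.range (a ∘ x)) with hV
      have hVa : V ≤ Submodule.span K (Set.range a) :=
        Submodule.span_mono (Set.range_comp_subset_range x a)
      have hp : 0 ≤ ∏ i, w (x i) := Finset.prod_nonneg fun i _ => hw _
      have hr : ∀ j, Module.finrank K V + (if a j ∈ V then 0 else 1) ≤ Module.finrank K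
          (Submodule.span K (Set.range (a ∘ (Fin.cons j x : Fin (d + 1) → Fin n)))) := by
        intro j
        have hle : V ≤
            Submodule.span K (Set.range (a ∘ (Fin.cons j x : Fin (d + 1) → Fin n))) := by
          refine Submodule.span_mono ?_
          rintro _ ⟨i, rfl⟩
          exact ⟨i.succ, by simp⟩
        split_ifs with hj
        · simpa using Submodule.finrank_mono hle
        · refine Submodule.finrank_lt_finrank_of_lt (lt_of_le_of_ne hle fun heq => hj ?_)
          rw [heq]
          exact Submodule.subset_span ⟨0, by simp⟩
      calc _ = ∑ j, (∏ i, w (x i)) * (w j * ((k : ℝ) - Module.finrank K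
            (Submodule.span K (Set.range (a ∘ (Fin.cons j x : Fin (d + 1) → Fin n)))))) := by
            refine Finset.sum_congr rfl fun j _ => ?_
            rw [Fin.prod_univ_succ]
            simp only [Fin.cons_zero, Fin.cons_succ]
            ring
        _ ≤ ∑ j, (∏ i, w (x i)) * (w j * ((k : ℝ) - Module.finrank K V) -
              if a j ∈ V then 0 else w j) := by
            refine Finset.sum_le_sum fun j _ => mul_le_mul_of_nonneg_left ?_ hp
            have h1 : (Module.finrank K V : ℝ) + (if a j ∈ V then 0 else 1) ≤ Module.finrank K
                (Submodule.span K (Set.range (a ∘ (Fin.cons j x : Fin (d + 1) → Fin n)))) := by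
              have := hr j
              split_ifs at this ⊢ <;> exact_mod_cast this
            have h2 := mul_le_mul_of_nonneg_left h1 (hw j)
            split_ifs at h2 ⊢ <;> linarith
        _ = (∏ i, w (x i)) * (((k : ℝ) - Module.finrank K V) -
              ∑ j, if a j ∈ V then 0 else w j) := by
            rw [← Finset.mul_sum, Finset.sum_sub_distrib, ← Finset.sum_mul, hw1, one_mul]
        _ ≤ (∏ i, w (x i)) * ((1 - μ) * ((k : ℝ) - Module.finrank K V)) := by
            refine mul_le_mul_of_nonneg_left ?_ hp
            have := h V hVa
            linarith
        _ = _ := by ring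
    calc _ ≤ ∑ x : Fin d → Fin n, (1 - μ) * ((∏ i, w (x i)) *
          ((k : ℝ) - Module.finrank K (Submodule.span K (Set.range (a ∘ x))))) :=
          Finset.sum_le_sum fun x _ => step x
      _ ≤ (1 - μ) * (k * (1 - μ) ^ d) := by
          rw [← Finset.mul_sum]
          exact mul_le_mul_of_nonneg_left ih (by linarith)
      _ = _ := by ring

theorem weightMeasure_real_singleton {N : ℕ} (w : Fin N → ℝ) (hw : ∀ i, 0 ≤ w i) (i : Fin N) :
    (weightMeasure w).real {i} = w i := by
  simp [weightMeasure, Measure.real, Set.indicator_apply, hw]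

theorem pi_weightMeasure_real_singleton {N d : ℕ} (w : Fin N → ℝ) (hw : ∀ i, 0 ≤ w i)
    (x : Fin d → Fin N) :
    (Measure.pi fun _ : Fin d => weightMeasure w).real {x} = ∏ i, w (x i) := by
  rw [Measure.real, Measure.pi_singleton, ENNReal.toReal_prod]
  exact Finset.prod_congr rfl fun i _ => weightMeasure_real_singleton w hw _

/-- A sample misses the full span with probability at most `k (1 - μ) ^ d`. -/
theorem le_pi_real_spanning {K E : Type*} [Field K] [AddCommGroup E] [Module K E]
    [FiniteDimensional K E] {n : ℕ} (a : Fin n → E) (w : Fin n → ℝ) (hw : ∀ j, 0 ≤ w j)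
    (hw1 : ∑ j, w j = 1) {μ : ℝ} (hμ : μ ≤ 1)
    (h : ∀ V : Submodule K E, V ≤ Submodule.span K (Set.range a) →
      ((Module.finrank K (Submodule.span K (Set.range a)) : ℝ) - Module.finrank K V) * μ ≤
        ∑ j, open Classical in if a j ∈ V then 0 else w j)
    (d : ℕ) :
    1 - Module.finrank K (Submodule.span K (Set.range a)) * (1 - μ) ^ d ≤
      (Measure.pi fun _ : Fin d => weightMeasure w).real
        {x | ∀ j, a j ∈ Submodule.span K (Set.range (a ∘ x))} := by
  classical
  have := weightMeasure_univ w hw hw1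
  set P := Measure.pi fun _ : Fin d => weightMeasure w with hP
  set s : Set (Fin d → Fin n) := {x | ∀ j, a j ∈ Submodule.span K (Set.range (a ∘ x))}
  have hs : MeasurableSet s := (Set.toFinite s).measurableSet
  have h0 := probReal_compl_eq_one_sub (μ := P) hs
  have h1 := sum_prod_mul_codim_le a w hw hw1 _ hμ h d
  -- Markov's inequality: on the failure event the codimension is an integer that is at least one.
  suffices P.real sᶜ ≤ ∑ x : Fin d → Fin n, (∏ i, w (x i)) *
      ((Module.finrank K (Submodule.span K (Set.range a)) : ℝ) -
        Module.finrank K (Submodule.span K (Set.range (a ∘ x)))) by linarith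
  have h2 : P.real sᶜ = ∑ x ∈ Finset.univ.filter (· ∈ sᶜ), P.real {x} := by
    rw [sum_measureReal_singleton]
    congr 1
    ext x
    simp
  rw [h2, Finset.sum_filter]
  refine Finset.sum_le_sum fun x _ => ?_
  have hp : 0 ≤ ∏ i, w (x i) := Finset.prod_nonneg fun i _ => hw _
  have hle : Submodule.span K (Set.range (a ∘ x)) ≤ Submodule.span K (Set.range a) :=
    Submodule.span_mono (Set.range_comp_subset_range x a)
  split_ifs with hx
  · rw [pi_weightMeasure_real_singleton w hw]
    refine le_mul_of_one_le_right hp ?_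
    have : Module.finrank K (Submodule.span K (Set.range (a ∘ x))) + 1 ≤
        Module.finrank K (Submodule.span K (Set.range a)) := by
      refine Submodule.finrank_lt_finrank_of_lt (lt_of_le_of_ne hle fun heq => hx fun j => ?_)
      rw [heq]
      exact Submodule.subset_span ⟨j, rfl⟩
    have : (Module.finrank K (Submodule.span K (Set.range (a ∘ x))) : ℝ) + 1 ≤
        Module.finrank K (Submodule.span K (Set.range a)) := by exact_mod_cast this
    linarith
  · refine mul_nonneg hp (sub_nonneg.mpr ?_)
    exact_mod_cast Submodule.finrank_mono hle

/-- The length-squared weight outside a subspace `V` is at least proportional to the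
codimension of `V` in the span. -/
theorem codim_mul_le_sum_sq_notMem {𝕜 E : Type*} [RCLike 𝕜] [NormedAddCommGroup E]
    [InnerProductSpace 𝕜 E] [FiniteDimensional 𝕜 E] {n : ℕ} (a : Fin n → E) {s : ℝ}
    (h : ∀ u ∈ Submodule.span 𝕜 (Set.range a), ‖u‖ ^ 2 ≤ s ^ 2 * ∑ j, ‖inner 𝕜 u (a j)‖ ^ 2)
    (V : Submodule 𝕜 E) (hV : V ≤ Submodule.span 𝕜 (Set.range a)) :
    (Module.finrank 𝕜 (Submodule.span 𝕜 (Set.range a)) : ℝ) - Module.finrank 𝕜 V ≤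
      s ^ 2 * ∑ j, open Classical in if a j ∈ V then 0 else ‖a j‖ ^ 2 := by
  classical
  set F := Submodule.span 𝕜 (Set.range a)
  -- The codimension is the number of vectors in this basis. Applying `h` to each and exchanging
  -- sums, columns in `V` contribute nothing and every other column at most `‖a j‖ ^ 2`, by Bessel's
  -- inequality.
  set b := stdOrthonormalBasis 𝕜 (Vᗮ ⊓ F : Submodule 𝕜 E) with hb
  have hd : Module.finrank 𝕜 V + Module.finrank 𝕜 (Vᗮ ⊓ F : Submodule 𝕜 E) =
      Module.finrank 𝕜 F := Submodule.finrank_add_inf_finrank_orthogonal hV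
  have hd' : (Module.finrank 𝕜 V : ℝ) + Module.finrank 𝕜 (Vᗮ ⊓ F : Submodule 𝕜 E) =
      Module.finrank 𝕜 F := by exact_mod_cast hd
  have hon : Orthonormal 𝕜 (fun i => (b i : E)) :=
    b.orthonormal.comp_linearIsometry (Vᗮ ⊓ F : Submodule 𝕜 E).subtypeₗᵢ
  calc (Module.finrank 𝕜 F : ℝ) - Module.finrank 𝕜 V
      = ∑ i : Fin (Module.finrank 𝕜 (Vᗮ ⊓ F : Submodule 𝕜 E)), ‖(b i : E)‖ ^ 2 := by
        simp only [hon.1]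
        simp
        linarith
    _ ≤ ∑ i, s ^ 2 * ∑ j, ‖inner 𝕜 (b i : E) (a j)‖ ^ 2 :=
        Finset.sum_le_sum fun i _ => h _ (b i).2.2
    _ = s ^ 2 * ∑ j, ∑ i, ‖inner 𝕜 (b i : E) (a j)‖ ^ 2 := by
        rw [← Finset.mul_sum, Finset.sum_comm]
    _ ≤ _ := by
        refine mul_le_mul_of_nonneg_left (Finset.sum_le_sum fun j _ => ?_) (sq_nonneg s)
        split_ifs with hj
        · refine (Finset.sum_eq_zero fun i _ => ?_).le
          rw [Submodule.inner_left_of_mem_orthogonal hj (b i).2.1]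
          simp
        · exact hon.sum_inner_products_le (s := Finset.univ) (a j)

/-- Since `ε κ < 1`, the sample-size parameter `L` satisfies `μ L ≥ 1 / δ`, hence also `k ≤ L`. The
bound `k ≥ 2` keeps `log L` above `1 / 2`; rank one needs a separate argument. -/
theorem mul_one_sub_pow_le {k d : ℕ} {μ r κ ε δ : ℝ} (hk : 2 ≤ k) (hμ : 0 < μ)
    (hkμ : k * μ ≤ 1) (hr : μ * (r * κ ^ 2) = 1) (hκ : 1 ≤ κ) (hδ : 0 < δ) (hδ1 : δ < 1)
    (hε : 0 < ε) (hεκ : ε < κ⁻¹)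
    (hd : 3 * (r / (ε ^ 4 * δ) * Real.log (r / (ε ^ 4 * δ))) ≤ d) :
    k * (1 - μ) ^ d ≤ 2 * Real.exp (-1 / δ) := by
  have hk' : (2 : ℝ) ≤ k := by exact_mod_cast hk
  have hκ0 : 0 < κ := by linarith
  have hr0 : 0 < r := by
    by_contra! hc
    have : μ * (r * κ ^ 2) ≤ 0 :=
      mul_nonpos_of_nonneg_of_nonpos hμ.le (mul_nonpos_of_nonpos_of_nonneg hc (by positivity))
    linarith
  have hμ1 : μ ≤ 1 := by nlinarith
  set L := r / (ε ^ 4 * δ) with hL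
  have hεκ1 : ε * κ < 1 := by
    rw [lt_inv_comm₀ hε hκ0] at hεκ
    have := mul_lt_mul_of_pos_left hεκ hε
    rwa [mul_inv_cancel₀ hε.ne'] at this
  have hε1 : ε ≤ 1 := by nlinarith
  have hμL : 1 / δ ≤ μ * L := by
    have h4 : ε ^ 4 * κ ^ 2 ≤ 1 := by
      have h5 : (ε * κ) ^ 2 ≤ 1 := pow_le_one₀ (by positivity) hεκ1.le
      have h6 : ε ^ 2 ≤ 1 := pow_le_one₀ hε.le hε1
      calc ε ^ 4 * κ ^ 2 = ε ^ 2 * (ε * κ) ^ 2 := by ring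
        _ ≤ 1 := mul_le_one₀ h6 (by positivity) h5
    rw [hL, ← mul_div_assoc, div_le_div_iff₀ hδ (by positivity)]
    have : ε ^ 4 ≤ μ * r := by
      have h7 : ε ^ 4 * κ ^ 2 ≤ (μ * r) * κ ^ 2 := by nlinarith
      exact le_of_mul_le_mul_right h7 (by positivity)
    nlinarith
  have h1δ : 1 < 1 / δ := by rwa [lt_div_iff₀ hδ, one_mul]
  have hL0 : 0 < L := by positivity
  have hkL : (k : ℝ) ≤ L := by
    have : k * μ ≤ μ * L := by linarith
    rw [mul_comm] at this
    exact le_of_mul_le_mul_left this hμ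
  have hlogk : Real.log k ≤ Real.log L := Real.log_le_log (by linarith) hkL
  have hlog2 : Real.log 2 ≤ Real.log k := Real.log_le_log (by norm_num) hk'
  have hl2 := Real.log_two_gt_d9
  -- Origin of the constant 3: one copy of `(1 / δ) log L` absorbs `log k`, the other two absorb `1
  -- / δ` because `log L ≥ log 2 > 1 / 2`.
  have hexp : Real.log k + 1 / δ ≤ μ * d := by
    have h1 : μ * (3 * (L * Real.log L)) ≤ μ * d := mul_le_mul_of_nonneg_left hd hμ.le
    have h2 : 1 / δ * Real.log L ≤ μ * L * Real.log L :=
      mul_le_mul_of_nonneg_right hμL (by linarith)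
    have h3 : Real.log L ≤ 1 / δ * Real.log L := le_mul_of_one_le_left (by linarith) h1δ.le
    have h4 : 1 / δ * (1 / 2) ≤ 1 / δ * Real.log L :=
      mul_le_mul_of_nonneg_left (by linarith) (by linarith)
    linarith
  calc (k : ℝ) * (1 - μ) ^ d ≤ k * Real.exp (-μ) ^ d := by
        have := Real.one_sub_le_exp_neg μ
        gcongr
    _ = Real.exp (Real.log k - μ * d) := by
        rw [sub_eq_add_neg, Real.exp_add, Real.exp_log (by linarith), ← Real.exp_nat_mul]
        ring_nf
    _ ≤ Real.exp (-1 / δ) := by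
        refine Real.exp_le_exp.mpr ?_
        rw [neg_div]
        linarith
    _ ≤ _ := by linarith [Real.exp_pos (-1 / δ)]

/-! ### Exactness of the CUR decomposition -/

section CUR

variable {𝕜 : Type*} [RCLike 𝕜] {m n : ℕ} {α β : Type*} [Fintype α] [Fintype β]
  {A : Matrix (Fin m) (Fin n) 𝕜} {I : α → Fin m} {J : β → Fin n}

theorem eq_cols_mul_curY {X : Matrix β (Fin n) 𝕜} {W : Matrix (Fin m) α 𝕜}
    (hX : A = A.submatrix id J * X) (hW : A = W * A.submatrix I id) :
    A = A.submatrix id J * curY A I J := by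
  have hC : A.submatrix id J = W * A.submatrix I J := by
    conv_lhs => rw [hW]
    ext i j
    simp [Matrix.mul_apply]
  have hR : A.submatrix I id = A.submatrix I J * X := by
    conv_lhs => rw [hX]
    ext i j
    simp [Matrix.mul_apply]
  symm
  calc A.submatrix id J * curY A I J
      = W * (A.submatrix I J * pinv (A.submatrix I J) * A.submatrix I J) * X := by
        rw [curY, hC, hR]
        simp only [Matrix.mul_assoc]
    _ = A := by rw [(isMoorePenrose_pinv _).mul_mul_self, Matrix.mul_assoc, ← hR, ← hW]

theorem pinv_mul_self_mul_curY :
    pinv (A.submatrix I J) * A.submatrix I J * curY A I J = curY A I J := by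
  rw [curY, ← Matrix.mul_assoc, (isMoorePenrose_pinv _).self_mul_mul]

/-- Rank-nullity for the addition map from the product of the `S i`: its range has the full
dimension of the product, so its kernel is trivial. -/
theorem IndependentSubspaces.eq_zero_of_sum_eq_zero {l : ℕ}
    {S : Fin l → Submodule 𝕜 (Fin m → 𝕜)} (hS : IndependentSubspaces S)
    (f : Fin l → Fin m → 𝕜) (hf : ∀ i, f i ∈ S i) (h0 : ∑ i, f i = 0) (i : Fin l) : f i = 0 := by
  let φ : (∀ i, S i) →ₗ[𝕜] (Fin m → 𝕜) := ∑ i, (S i).subtype ∘ₗ LinearMap.proj i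
  have hφ : ∀ g, φ g = ∑ i, (g i : Fin m → 𝕜) := fun g => by simp [φ]
  have hle : (⨆ i, S i) ≤ LinearMap.range φ := by
    refine iSup_le fun i v hv => ⟨Pi.single i ⟨v, hv⟩, ?_⟩
    rw [hφ, Finset.sum_eq_single i]
    · simp
    · intro j _ hj
      simp [Pi.single_eq_of_ne hj]
    · simp
  have h1 := LinearMap.finrank_range_add_finrank_ker φ
  rw [Module.finrank_pi_fintype, ← show _ = _ from hS] at h1
  have h2 := Submodule.finrank_mono hle
  have h3 : LinearMap.ker φ = ⊥ := Submodule.finrank_eq_zero.mp (by omega)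
  have h4 : (fun i => (⟨f i, hf i⟩ : S i)) ∈ LinearMap.ker φ := by
    rw [LinearMap.mem_ker, hφ]
    exact h0
  rw [h3, Submodule.mem_bot] at h4
  exact congrArg Subtype.val (congrFun h4 i)

/-- The columns of `Y` belonging to a subspace are supported on the sampled columns belonging to
that subspace. -/
theorem curY_eq_zero_of_ne {l : ℕ} {S : Fin l → Submodule 𝕜 (Fin m → 𝕜)}
    (hS : IndependentSubspaces S) {blk : Fin n → Fin l} (hblk : ∀ j, A.col j ∈ S (blk j))
    {W : Matrix (Fin m) α 𝕜} (hW : A = W * A.submatrix I id)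
    (hCY : A = A.submatrix id J * curY A I J) (b : β) (q : Fin n) (hbq : blk (J b) ≠ blk q) :
    curY A I J b q = 0 := by
  classical
  set U := A.submatrix I J with hU
  set C := A.submatrix id J with hC
  set Y := curY A I J with hY
  set P := pinv U * U with hP
  have hCU : C = W * U := by
    rw [hC]
    conv_lhs => rw [hW]
    ext i j
    simp [Matrix.mul_apply, hU]
  have hPY : P * Y = Y := pinv_mul_self_mul_curY
  -- Coordinate projection onto the sampled columns of block `i`.
  let D : Fin l → Matrix β β 𝕜 := fun i =>
    Matrix.diagonal fun b => if blk (J b) = i then 1 else 0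
  have hmem : ∀ (i : Fin l) (v : β → 𝕜), C *ᵥ (D i *ᵥ v) ∈ S i := by
    intro i v
    have hCv : ∀ w : β → 𝕜, C *ᵥ w = ∑ b, w b • A.col (J b) := by
      intro w
      ext r
      simp [Matrix.mulVec, dotProduct, hC, mul_comm]
    rw [hCv]
    refine Submodule.sum_mem _ fun b _ => ?_
    simp only [D, Matrix.mulVec_diagonal]
    split_ifs with h
    · refine Submodule.smul_mem _ _ ?_
      rw [← h]
      exact hblk (J b)
    · simp
  have hsum : ∀ v : β → 𝕜, ∑ i, C *ᵥ (D i *ᵥ v) = C *ᵥ v := by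
    intro v
    have hv : ∑ i, D i *ᵥ v = v := by
      ext b
      simp [D, Matrix.mulVec_diagonal]
    conv_rhs => rw [← hv]
    exact (map_sum C.mulVecLin _ _).symm
  have hPv : ∀ v : β → 𝕜, C *ᵥ v = 0 → P *ᵥ v = 0 := by
    intro v hv
    have : U *ᵥ v = 0 := by
      ext a
      exact congrFun hv (I a)
    rw [hP, ← Matrix.mulVec_mulVec, this, Matrix.mulVec_zero]
  have hCP : C * P = C := by
    rw [hCU, hP, Matrix.mul_assoc, ← Matrix.mul_assoc U, (isMoorePenrose_pinv U).mul_mul_self]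
  have hPh : Pᴴ = P := (isMoorePenrose_pinv U).isHermitian_right.eq
  clear_value P
  -- `P e - e` lies in `ker C`, which `D i` preserves by independence, and `P` kills `ker C`. Taking
  -- adjoints of this identity then gives commutation.
  have hPD : ∀ i, P * D i * P = P * D i := by
    intro i
    refine Matrix.ext_of_mulVec_single fun b => ?_
    rw [← sub_eq_zero, ← Matrix.sub_mulVec]
    set v : β → 𝕜 := P *ᵥ Pi.single b 1 - Pi.single b 1 with hv
    have hv0 : C *ᵥ v = 0 := by
      rw [hv, Matrix.mulVec_sub, Matrix.mulVec_mulVec, hCP, sub_self]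
    have h1 := hS.eq_zero_of_sum_eq_zero _ (fun i => hmem i v) ((hsum v).trans hv0) i
    have h2 := hPv _ h1
    rw [hv, Matrix.mulVec_sub, Matrix.mulVec_sub, Matrix.mulVec_mulVec, Matrix.mulVec_mulVec,
      Matrix.mulVec_mulVec, ← Matrix.sub_mulVec] at h2
    exact h2
  have hDh : ∀ i, (D i)ᴴ = D i := by
    intro i
    rw [Matrix.diagonal_conjTranspose]
    congr 1
    ext b
    simp [apply_ite]
  have hcomm : ∀ i, P * D i = D i * P := by
    intro i
    have h1 := congrArg Matrix.conjTranspose (hPD i)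
    rw [Matrix.conjTranspose_mul, Matrix.conjTranspose_mul, hPh, hDh, ← Matrix.mul_assoc,
      hPD] at h1
    exact h1
  set i := blk q with hi
  set y : β → 𝕜 := Y.col q with hy
  have hPy : P *ᵥ y = y := by
    ext b
    exact congrFun (congrFun hPY b) q
  have hCy : C *ᵥ y = A.col q := by
    ext r
    exact (congrFun (congrFun hCY r) q).symm
  -- The block components of `C y = A.col q` are compared; only component `i` survives.
  have h0 : C *ᵥ (D i *ᵥ y - y) = 0 := by
    have h1 := hS.eq_zero_of_sum_eq_zero
      (fun j => C *ᵥ (D j *ᵥ y) - if j = i then A.col q else 0)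
      (fun j => Submodule.sub_mem _ (hmem j y) (by
        split_ifs with h
        · rw [h]; exact hblk q
        · exact Submodule.zero_mem _))
      (by rw [Finset.sum_sub_distrib, hsum, hCy]; simp) i
    rw [Matrix.mulVec_sub, hCy]
    simpa using h1
  have h2 := hPv _ h0
  rw [Matrix.mulVec_sub, Matrix.mulVec_mulVec, hcomm, ← Matrix.mulVec_mulVec, hPy,
    sub_eq_zero] at h2
  have h3 := congrFun h2 b
  rw [Matrix.mulVec_diagonal, if_neg hbq, zero_mul] at h3
  exact h3.symm

end CUR

/-! ### Powers of nonnegative matrices -/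

section Powers

variable {ι : Type*} [Fintype ι] [DecidableEq ι] {G : Matrix ι ι ℝ}

theorem pow_apply_nonneg_of_nonneg (hG : ∀ p q, 0 ≤ G p q) (t : ℕ) (p q : ι) :
    0 ≤ (G ^ t) p q := by
  induction t generalizing q with
  | zero => rw [pow_zero, Matrix.one_apply]; split_ifs <;> norm_num
  | succ t ih =>
    rw [pow_succ, Matrix.mul_apply]
    exact Finset.sum_nonneg fun s _ => mul_nonneg (ih s) (hG s q)

theorem pow_succ_apply_ne_zero_iff (hG : ∀ p q, 0 ≤ G p q) (t : ℕ) (p q : ι) :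
    (G ^ (t + 1)) p q ≠ 0 ↔ ∃ s, (G ^ t) p s ≠ 0 ∧ G s q ≠ 0 := by
  rw [pow_succ, Matrix.mul_apply, Ne, Finset.sum_eq_zero_iff_of_nonneg fun s _ =>
    mul_nonneg (pow_apply_nonneg_of_nonneg hG t p s) (hG s q)]
  simp

theorem pow_apply_ne_zero_of_le (hG : ∀ p q, 0 ≤ G p q) {q : ι} (hq : G q q ≠ 0) {p : ι}
    {s t : ℕ} (hst : s ≤ t) (h : (G ^ s) p q ≠ 0) : (G ^ t) p q ≠ 0 := by
  induction t, hst using Nat.le_induction with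
  | base => exact h
  | succ t _ ih => exact (pow_succ_apply_ne_zero_iff hG t p q).mpr ⟨q, ih, hq⟩

theorem eq_of_pow_apply_ne_zero (hG : ∀ p q, 0 ≤ G p q) {γ : Type*} {f : ι → γ}
    (hf : ∀ p q, G p q ≠ 0 → f p = f q) (t : ℕ) (p q : ι) (h : (G ^ t) p q ≠ 0) :
    f p = f q := by
  induction t generalizing q with
  | zero =>
    rw [pow_zero, Matrix.one_apply] at h
    split_ifs at h with hpq
    · rw [hpq]
    · exact absurd rfl h
  | succ t ih =>
    obtain ⟨s, h1, h2⟩ := (pow_succ_apply_ne_zero_iff hG t p q).mp h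
    exact (ih s h1).trans (hf s q h2)

end Powers

/-! ### The non-orthogonality graph of generic vectors -/

/-- For more than `d` generic vectors spanning a space of dimension `d`, the graph of
non-orthogonal pairs has diameter at most `d`. -/
theorem pow_apply_ne_zero_of_generic {𝕜 E ι : Type*} [RCLike 𝕜] [NormedAddCommGroup E]
    [InnerProductSpace 𝕜 E] [FiniteDimensional 𝕜 E] [Fintype ι] [DecidableEq ι]
    {G : Matrix ι ι ℝ} (hG : ∀ p q, 0 ≤ G p q) {y : ι → E}
    (hGy : ∀ p q, G p q = 0 ↔ inner 𝕜 (y p) (y q) = 0) {K : Set ι} {d : ℕ}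
    (hgen : ∀ W : Submodule 𝕜 E, Module.finrank 𝕜 W < d →
      (y '' K ∩ W).ncard ≤ Module.finrank 𝕜 W)
    (hcard : 2 ≤ d → d < (y '' K).ncard)
    (hdim : Module.finrank 𝕜 (Submodule.span 𝕜 (y '' K)) ≤ d)
    (hne : ∀ p ∈ K, y p ≠ 0) {D : ℕ} (hD : d ≤ D) {p q : ι} (hp : p ∈ K) (hq : q ∈ K) :
    (G ^ D) p q ≠ 0 := by
  have hdiag : ∀ q ∈ K, G q q ≠ 0 := fun q hq => by
    rw [Ne, hGy, inner_self_eq_zero]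
    exact hne q hq
  -- Vertices of `K` reachable from `p` by a walk of length `t`; `W t` is the span of their vectors.
  let N : ℕ → Set ι := fun t => {q ∈ K | (G ^ t) p q ≠ 0}
  let W : ℕ → Submodule 𝕜 E := fun t => Submodule.span 𝕜 (y '' N t)
  set F := Submodule.span 𝕜 (y '' K) with hF
  have hNK : ∀ t, N t ⊆ K := fun t => Set.sep_subset _ _
  have hWF : ∀ t, W t ≤ F := fun t => Submodule.span_mono (Set.image_mono (hNK t))
  have hWmono : ∀ t, W t ≤ W (t + 1) := fun t =>
    Submodule.span_mono <| Set.image_mono fun q hq =>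
      ⟨hq.1, pow_apply_ne_zero_of_le hG (hdiag q hq.1) (Nat.le_succ t) hq.2⟩
  have horth : ∀ t, ∀ q ∈ K, q ∉ N (t + 1) → y q ∈ (W t)ᗮ := by
    intro t q hq hqN
    refine (Submodule.mem_orthogonal _ _).mpr fun u hu => ?_
    induction hu using Submodule.span_induction with
    | mem u hu =>
      obtain ⟨s, hs, rfl⟩ := hu
      by_contra hsq
      exact hqN ⟨hq, (pow_succ_apply_ne_zero_iff hG t p q).mpr ⟨s, hs.2, by rwa [Ne, hGy]⟩⟩
    | zero => exact inner_zero_left _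
    | add u v _ _ hu hv => rw [inner_add_left, hu, hv, add_zero]
    | smul c u _ hu => rw [inner_smul_left, hu, mul_zero]
  have hpos : ∀ t, 1 ≤ Module.finrank 𝕜 (W t) := by
    intro t
    refine Submodule.one_le_finrank_iff.mpr fun h => hne p hp ?_
    have : y p ∈ W t := Submodule.subset_span ⟨p, ⟨hp, pow_apply_ne_zero_of_le hG (hdiag p hp)
      (Nat.zero_le t) (by simp)⟩, rfl⟩
    rwa [h, Submodule.mem_bot] at this
  have hgrow : ∀ t, min (t + 1) d ≤ Module.finrank 𝕜 (W t) := by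
    intro t
    induction t with
    | zero => exact (min_le_left _ _).trans (hpos 0)
    | succ t ih =>
      have hm := Submodule.finrank_mono (hWmono t)
      rcases hm.lt_or_eq with hlt | heq
      · omega
      by_contra! hlt
      have hwd : Module.finrank 𝕜 (W t) < d := by omega
      have hWeq : W t = W (t + 1) := Submodule.eq_of_le_of_finrank_eq (hWmono t) heq
      -- If the span stagnates below dimension `d`, every point lies in `W t` or is orthogonal to
      -- it. Genericity bounds the two parts by their dimensions, which add up to at most `d`,
      -- against `hcard`.
      have hcov : y '' K ⊆ (y '' K ∩ W t) ∪ (y '' K ∩ ((W t)ᗮ ⊓ F : Submodule 𝕜 E)) := by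
        rintro _ ⟨q, hq, rfl⟩
        by_cases hqN : q ∈ N (t + 1)
        · refine Or.inl ⟨⟨q, hq, rfl⟩, ?_⟩
          rw [hWeq]
          exact Submodule.subset_span ⟨q, hqN, rfl⟩
        · exact Or.inr ⟨⟨q, hq, rfl⟩, horth t q hq hqN, Submodule.subset_span ⟨q, hq, rfl⟩⟩
      have hdimF : Module.finrank 𝕜 (W t) + Module.finrank 𝕜 ((W t)ᗮ ⊓ F : Submodule 𝕜 E) =
        Module.finrank 𝕜 F := Submodule.finrank_add_inf_finrank_orthogonal (hWF t)
      have h1 := hpos t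
      have h2 := hgen (W t) hwd
      have h3 := hgen ((W t)ᗮ ⊓ F : Submodule 𝕜 E) (by omega)
      have h4 := (Set.ncard_le_ncard hcov (Set.toFinite _)).trans (Set.ncard_union_le _ _)
      have h5 := hcard (by omega)
      omega
  have hd1 : 1 ≤ d := (hpos 0).trans ((Submodule.finrank_mono (hWF 0)).trans hdim)
  -- `W 0` already has dimension at least one, so `d - 1` steps fill `F`. A nonzero vector of `F` is
  -- not orthogonal to `F`, and one last step reaches it.
  have hfull : W (d - 1) = F := by
    refine Submodule.eq_of_le_of_finrank_le (hWF _) ?_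
    have := hgrow (d - 1)
    omega
  refine pow_apply_ne_zero_of_le hG (hdiag q hq) hD ?_
  by_contra h0
  have hqo : y q ∈ (W (d - 1))ᗮ := by
    refine horth (d - 1) q hq fun hqN => hqN.2 ?_
    rw [Nat.sub_add_cancel hd1]
    exact h0
  have hqF : y q ∈ W (d - 1) := by
    rw [hfull]
    exact Submodule.subset_span ⟨q, hq, rfl⟩
  exact hne q hq (inner_self_eq_zero.mp ((Submodule.mem_orthogonal _ _).mp hqo _ hqF))

/-! ### Clustering -/

/-- Otherwise `dim W + 1` data points in `W` could be enlarged to `dim S` data points; these are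
independent, which is too many independent vectors in `W`. In dimension one no enlargement is
needed. -/
theorem IsGeneric.ncard_inter_le {𝕜 : Type*} [RCLike 𝕜] {m : ℕ}
    {S : Submodule 𝕜 (Fin m → 𝕜)} {B : Set (Fin m → 𝕜)} (hB : IsGeneric S B) (hfin : B.Finite)
    (hcard : 2 ≤ Module.finrank 𝕜 S → Module.finrank 𝕜 S < B.ncard)
    (W : Submodule 𝕜 (Fin m → 𝕜)) (hW : Module.finrank 𝕜 W < Module.finrank 𝕜 S) :
    (B ∩ W).ncard ≤ Module.finrank 𝕜 W := by
  classical
  by_contra! hlt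
  obtain ⟨T, hTB, hT⟩ := Set.exists_subset_card_eq (Nat.succ_le_of_lt hlt)
  have hTfin : T.Finite := (hfin.inter_of_left _).subset hTB
  have hsub : hTfin.toFinset ⊆ hfin.toFinset := by
    rw [Set.Finite.toFinset_subset_toFinset]
    exact hTB.trans Set.inter_subset_left
  rw [Set.ncard_eq_toFinset_card T hTfin] at hT
  rw [Set.ncard_eq_toFinset_card B hfin] at hcard
  have hle := Finset.card_le_card hsub
  obtain ⟨T', hTT', hT'B, hT'⟩ := Finset.exists_subsuperset_card_eq hsub
    (n := Module.finrank 𝕜 S) (by omega) (by omega)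
  have hli : LinearIndepOn 𝕜 id (T : Set (Fin m → 𝕜)) :=
    (hB T' (fun v hv => by simpa using hT'B hv) hT').mono fun v hv =>
      hTT' (by simpa using hv)
  have hspan : Module.finrank 𝕜 (Submodule.span 𝕜 T) = hTfin.toFinset.card := by
    have : Fintype T := hTfin.fintype
    rw [finrank_span_set_eq_card hli]
    congr 1
    ext
    simp
  have := Submodule.finrank_mono
    (Submodule.span_le.mpr (hTB.trans Set.inter_subset_right) : Submodule.span 𝕜 T ≤ W)
  omega

/-- The whole deterministic half: the factorizations `hX` and `hW` are all that is required of the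
sample. -/
theorem curClusters_of_factor {𝕜 : Type*} [RCLike 𝕜] {m n l : ℕ} {α β : Type*} [Fintype α]
    [Fintype β] {A : Matrix (Fin m) (Fin n) 𝕜} {S : Fin l → Submodule 𝕜 (Fin m → 𝕜)}
    (hA : A ≠ 0) (hcol : ∀ j, ∃ i, A.col j ∈ S i) (hS : IndependentSubspaces S)
    (hgen : ∀ i, IsGeneric (S i) (dataIn A (S i)))
    (hcard : ∀ i, 2 ≤ Module.finrank 𝕜 (S i) →
      Module.finrank 𝕜 (S i) < (dataIn A (S i)).ncard)
    {I : α → Fin m} {J : β → Fin n} {X : Matrix β (Fin n) 𝕜} {W : Matrix (Fin m) α 𝕜}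
    (hX : A = A.submatrix id J * X) (hW : A = W * A.submatrix I id) : CURClusters A S I J := by
  classical
  have hCY := eq_cols_mul_curY hX hW
  refine ⟨by rw [Matrix.mul_assoc]; exact hCY, ?_⟩
  choose blk hblk using hcol
  have hdata : ∀ i, dataIn A (S i) = A.col '' {p | A.col p ∈ S i} := by
    intro i
    ext v
    constructor
    · rintro ⟨hv, j, rfl⟩
      exact ⟨j, hv, rfl⟩
    · rintro ⟨j, hj, rfl⟩
      exact ⟨hj, j, rfl⟩
  have hfin : ∀ i, (dataIn A (S i)).Finite := fun i => by
    rw [hdata]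
    exact Set.toFinite _
  -- A zero column would be a data point of every `S i`, contradicting genericity in one of positive
  -- dimension, which exists as `A ≠ 0`.
  have hcol0 : ∀ q, A.col q ≠ 0 := by
    intro q hq
    obtain ⟨p, hp⟩ : ∃ p, A.col p ≠ 0 := by
      by_contra! h
      refine hA (Matrix.ext fun i j => congrFun (h j) i)
    have hd : 1 ≤ Module.finrank 𝕜 (S (blk p)) :=
      Submodule.one_le_finrank_iff.mpr fun h => hp (by simpa [h] using hblk p)
    have h1 := (hgen (blk p)).ncard_inter_le (hfin _) (hcard _) ⊥ (by rwa [finrank_bot])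
    rw [finrank_bot, Nat.le_zero, Set.ncard_eq_zero ((hfin _).inter_of_left _)] at h1
    have : (0 : Fin m → 𝕜) ∈ dataIn A (S (blk p)) ∩ (⊥ : Submodule 𝕜 (Fin m → 𝕜)) :=
      ⟨⟨Submodule.zero_mem _, q, hq⟩, rfl⟩
    rw [h1] at this
    exact this
  have huniq : ∀ p i, A.col p ∈ S i → blk p = i := by
    intro p i hi
    by_contra hne
    have := hS.eq_zero_of_sum_eq_zero
      (fun j => (if j = blk p then A.col p else 0) - if j = i then A.col p else 0)
      (fun j => Submodule.sub_mem _
        (by split_ifs with h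
            · rw [h]; exact hblk p
            · exact Submodule.zero_mem _)
        (by split_ifs with h
            · rw [h]; exact hi
            · exact Submodule.zero_mem _))
      (by simp) i
    simp [Ne.symm hne, hcol0 p] at this
  set Y := curY A I J with hY
  let y : Fin n → EuclideanSpace 𝕜 β := fun p => WithLp.toLp 2 (Y.col p)
  have hQ : ∀ p q, curQ A I J p q = ‖inner 𝕜 (y p) (y q)‖ := by
    intro p q
    simp [curQ, Matrix.mul_apply, y, PiLp.inner_apply, ← hY, mul_comm]
  have hQ0 : ∀ p q, 0 ≤ curQ A I J p q := fun p q => by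
    rw [hQ]
    exact norm_nonneg _
  -- `c` and `M` exchange the columns of `Y` and of `A`, so genericity, cardinality and dimension
  -- bounds transfer to the vectors `y p`.
  let c : EuclideanSpace 𝕜 β →ₗ[𝕜] (Fin m → 𝕜) :=
    (A.submatrix id J).mulVecLin ∘ₗ (WithLp.linearEquiv 2 𝕜 (β → 𝕜)).toLinearMap
  let M : (Fin m → 𝕜) →ₗ[𝕜] EuclideanSpace 𝕜 β :=
    (WithLp.linearEquiv 2 𝕜 (β → 𝕜)).symm.toLinearMap ∘ₗ
      (pinv (A.submatrix I J)).mulVecLin ∘ₗ LinearMap.funLeft 𝕜 𝕜 I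
  have hc : ∀ p, c (y p) = A.col p := by
    intro p
    ext i
    exact (congrFun (congrFun hCY i) p).symm
  have hM : ∀ p, M (A.col p) = y p := fun p => rfl
  have hy0 : ∀ p, y p ≠ 0 := fun p h => hcol0 p (by rw [← hc, h, map_zero])
  intro p q
  constructor
  · intro h
    have hpq := eq_of_pow_apply_ne_zero hQ0 (f := blk) (fun p q hpq => by
      by_contra hne
      apply hpq
      rw [hQ, norm_eq_zero, PiLp.inner_apply]
      refine Finset.sum_eq_zero fun b _ => ?_
      by_cases hb : blk (J b) = blk q
      · have : Y b p = 0 := curY_eq_zero_of_ne hS hblk hW hCY b p (by rw [hb]; exact Ne.symm hne)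
        simp [y, this]
      · have : Y b q = 0 := curY_eq_zero_of_ne hS hblk hW hCY b q hb
        simp [y, this]) _ p q h
    exact ⟨blk p, hblk p, by rw [hpq]; exact hblk q⟩
  · rintro ⟨i, hp, hq⟩
    have himg : y '' {p | A.col p ∈ S i} = M '' dataIn A (S i) := by
      rw [hdata, Set.image_image]
      rfl
    have hcM : ∀ v ∈ dataIn A (S i), c (M v) = v := by
      rintro _ ⟨_, j, rfl⟩
      rw [hM, hc]
    refine pow_apply_ne_zero_of_generic (𝕜 := 𝕜) (y := y) (K := {p | A.col p ∈ S i})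
      (d := Module.finrank 𝕜 (S i)) hQ0 (fun p q => by rw [hQ, norm_eq_zero]) ?_ ?_ ?_
      (fun p _ => hy0 p) ?_ hp hq
    · intro V hV
      have hle : Module.finrank 𝕜 (V.map c) ≤ Module.finrank 𝕜 V := Submodule.finrank_map_le c V
      refine le_trans ?_ (((hgen i).ncard_inter_le (hfin i) (hcard i) (V.map c)
        (hle.trans_lt hV)).trans hle)
      refine Set.ncard_le_ncard_of_injOn c ?_ ?_ ((hfin i).inter_of_left _)
      · rintro _ ⟨⟨p, hp, rfl⟩, hpV⟩
        exact ⟨by rw [hc]; exact ⟨hp, p, rfl⟩, _, hpV, rfl⟩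
      · rintro _ ⟨⟨p, hp, rfl⟩, _⟩ _ ⟨⟨q, hq, rfl⟩, _⟩ hpq
        rw [hc, hc] at hpq
        rw [← hM, hpq, hM]
    · intro h2
      rw [himg, Set.InjOn.ncard_image]
      · exact hcard i h2
      · intro u hu v hv huv
        rw [← hcM u hu, huv, hcM v hv]
    · rw [himg]
      calc _ ≤ Module.finrank 𝕜 ((S i).map M) := by
            refine Submodule.finrank_mono (Submodule.span_le.mpr ?_)
            exact Set.image_mono fun v hv => hv.1
        _ ≤ _ := Submodule.finrank_map_le M _
    · exact Finset.le_sup (f := fun i => Module.finrank 𝕜 (S i)) (Finset.mem_univ i)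

/-! ### Sampling enough columns -/

/-- The right-hand side depends only on `Set.range J`, so dropping repeated indices changes nothing.
-/
theorem exists_eq_cols_mul_iff {𝕜 : Type*} [RCLike 𝕜] {m n : ℕ} {β : Type*} [Fintype β]
    (A : Matrix (Fin m) (Fin n) 𝕜) (J : β → Fin n) :
    (∃ X : Matrix β (Fin n) 𝕜, A = A.submatrix id J * X) ↔
      ∀ j, A.col j ∈ Submodule.span 𝕜 (A.col '' Set.range J) := by
  have hr : A.col '' Set.range J = Set.range (A.submatrix id J).col := by
    rw [← Set.range_comp]
    rfl
  rw [hr, ← Matrix.range_mulVecLin]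
  constructor
  · rintro ⟨X, hX⟩ j
    refine ⟨X.col j, ?_⟩
    ext i
    exact (congrFun (congrFun hX i) j).symm
  · intro h
    choose x hx using h
    refine ⟨Matrix.of fun b j => x j b, ?_⟩
    ext i j
    exact (congrFun (hx j) i).symm

/-! ### Norm and pseudoinverse estimates -/

theorem frobSq_nonneg {𝕜 : Type*} [RCLike 𝕜] {m n : ℕ} (A : Matrix (Fin m) (Fin n) 𝕜) :
    0 ≤ frobSq A := by
  unfold frobSq
  positivity

theorem frobSq_pos {𝕜 : Type*} [RCLike 𝕜] {m n : ℕ} {A : Matrix (Fin m) (Fin n) 𝕜}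
    (hA : A ≠ 0) : 0 < frobSq A := by
  refine lt_of_le_of_ne (frobSq_nonneg A) fun h => hA ?_
  ext i j
  have h1 := (Finset.sum_eq_zero_iff_of_nonneg
    (fun i _ => Finset.sum_nonneg fun j _ => by positivity)).mp h.symm i (Finset.mem_univ i)
  have h2 := (Finset.sum_eq_zero_iff_of_nonneg
    (fun j _ => by positivity)).mp h1 j (Finset.mem_univ j)
  simpa using h2

theorem frobSq_conjTranspose {𝕜 : Type*} [RCLike 𝕜] {m n : ℕ} (A : Matrix (Fin m) (Fin n) 𝕜) :
    frobSq Aᴴ = frobSq A := by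
  simp only [frobSq, Matrix.conjTranspose_apply, norm_star]
  exact Finset.sum_comm

theorem colProb_conjTranspose {𝕜 : Type*} [RCLike 𝕜] {m n : ℕ} (A : Matrix (Fin m) (Fin n) 𝕜) :
    colProb Aᴴ = rowProb A := by
  ext i
  simp only [colProb, rowProb, frobSq_conjTranspose, Matrix.conjTranspose_apply, norm_star]

theorem norm_mulVec_le_specNorm {𝕜 : Type*} [RCLike 𝕜] {m n : ℕ} (A : Matrix (Fin m) (Fin n) 𝕜)
    (v : Fin n → 𝕜) :
    ‖WithLp.toLp 2 (A *ᵥ v)‖ ≤ specNorm A * ‖WithLp.toLp 2 v‖ :=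
  (Matrix.toEuclideanLin A).toContinuousLinearMap.le_opNorm (WithLp.toLp 2 v)

theorem specNorm_nonneg {𝕜 : Type*} [RCLike 𝕜] {m n : ℕ} (A : Matrix (Fin m) (Fin n) 𝕜) :
    0 ≤ specNorm A := norm_nonneg _

theorem one_le_condNumber {𝕜 : Type*} [RCLike 𝕜] {m n : ℕ} {A : Matrix (Fin m) (Fin n) 𝕜}
    (h : 0 < condNumber A) : 1 ≤ condNumber A := by
  have hA : 0 < specNorm A := by
    refine lt_of_le_of_ne (specNorm_nonneg A) fun h0 => ?_
    rw [condNumber, ← h0, zero_mul] at h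
    exact lt_irrefl _ h
  have hle : specNorm A ≤ condNumber A * specNorm A := by
    refine ContinuousLinearMap.opNorm_le_bound _
      (mul_nonneg h.le hA.le) fun v => ?_
    have h1 := norm_mulVec_le_specNorm A ((pinv A * A) *ᵥ v.ofLp)
    have h2 := norm_mulVec_le_specNorm (pinv A) (A *ᵥ v.ofLp)
    have h3 := norm_mulVec_le_specNorm A v.ofLp
    rw [Matrix.mulVec_mulVec, ← Matrix.mul_assoc, (isMoorePenrose_pinv A).mul_mul_self] at h1
    rw [Matrix.mulVec_mulVec] at h2
    calc _ ≤ specNorm A * (specNorm (pinv A) * (specNorm A * ‖v‖)) :=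
          h1.trans (mul_le_mul_of_nonneg_left
            (h2.trans (mul_le_mul_of_nonneg_left h3 (specNorm_nonneg _))) hA.le)
      _ = _ := by rw [condNumber]; ring
  exact le_of_mul_le_mul_right (by linarith) hA

/-- `‖u‖² = ⟨u, A A† u⟩ = ⟨Aᴴ u, A† u⟩`, followed by Cauchy–Schwarz. -/
theorem norm_sq_toLp_le_of_mem_range {𝕜 : Type*} [RCLike 𝕜] {m n : ℕ}
    (A : Matrix (Fin m) (Fin n) 𝕜) (u : Fin m → 𝕜) (hu : A *ᵥ (pinv A *ᵥ u) = u) :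
    ‖WithLp.toLp 2 u‖ ^ 2 ≤ specNorm (pinv A) ^ 2 * ‖WithLp.toLp 2 (Aᴴ *ᵥ u)‖ ^ 2 := by
  have h1 : ‖WithLp.toLp 2 u‖ ^ 2 ≤
      ‖WithLp.toLp 2 (Aᴴ *ᵥ u)‖ * ‖WithLp.toLp 2 (pinv A *ᵥ u)‖ := by
    have h2 : inner 𝕜 (WithLp.toLp 2 (Aᴴ *ᵥ u)) (WithLp.toLp 2 (pinv A *ᵥ u)) =
        inner 𝕜 (WithLp.toLp 2 u) (WithLp.toLp 2 u) := by
      rw [EuclideanSpace.inner_toLp_toLp, EuclideanSpace.inner_toLp_toLp, Matrix.star_mulVec,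
        Matrix.conjTranspose_conjTranspose, dotProduct_comm, ← Matrix.dotProduct_mulVec, hu,
        dotProduct_comm]
    have h3 := norm_inner_le_norm (𝕜 := 𝕜) (WithLp.toLp 2 (Aᴴ *ᵥ u))
      (WithLp.toLp 2 (pinv A *ᵥ u))
    rw [h2, inner_self_eq_norm_sq_to_K] at h3
    simpa using h3
  have h4 := norm_mulVec_le_specNorm (pinv A) u
  rcases eq_or_lt_of_le (norm_nonneg (WithLp.toLp 2 u)) with h0 | h0
  · rw [← h0, zero_pow two_ne_zero]
    positivity
  have h5 : ‖WithLp.toLp 2 u‖ ≤ specNorm (pinv A) * ‖WithLp.toLp 2 (Aᴴ *ᵥ u)‖ := by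
    refine le_of_mul_le_mul_right ?_ h0
    calc _ = ‖WithLp.toLp 2 u‖ ^ 2 := by ring
      _ ≤ ‖WithLp.toLp 2 (Aᴴ *ᵥ u)‖ * (specNorm (pinv A) * ‖WithLp.toLp 2 u‖) :=
        h1.trans (mul_le_mul_of_nonneg_left h4 (norm_nonneg _))
      _ = _ := by ring
  rw [← mul_pow]
  exact pow_le_pow_left₀ h0.le h5 2

/-- Length-squared column sampling of a matrix whose smallest nonzero singular value is at least
`s⁻¹` yields a spanning set of columns. -/
theorem le_pi_real_exists_eq_cols_mul {𝕜 : Type*} [RCLike 𝕜] {m n : ℕ}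
    {A : Matrix (Fin m) (Fin n) 𝕜} (hA : A ≠ 0) {s r κ ε δ : ℝ} (hs : 0 < s)
    (h : ∀ v : Fin n → 𝕜, ‖WithLp.toLp 2 (A *ᵥ v)‖ ^ 2 ≤
      s ^ 2 * ‖WithLp.toLp 2 (Aᴴ *ᵥ (A *ᵥ v))‖ ^ 2)
    (hr : r * κ ^ 2 = s ^ 2 * frobSq A) (hκ : 1 ≤ κ) (hδ : 0 < δ) (hδ1 : δ < 1)
    (hε : 0 < ε) (hεκ : ε < κ⁻¹) {d : ℕ} (hd1 : 1 ≤ d)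
    (hd : 3 * (r / (ε ^ 4 * δ) * Real.log (r / (ε ^ 4 * δ))) ≤ d) :
    1 - 2 * Real.exp (-1 / δ) ≤ (Measure.pi fun _ : Fin d => weightMeasure (colProb A)).real
      {J | ∃ X : Matrix (Fin d) (Fin n) 𝕜, A = A.submatrix id J * X} := by
  classical
  have hF := frobSq_pos hA
  let a : Fin n → EuclideanSpace 𝕜 (Fin m) := fun j => WithLp.toLp 2 (A.col j)
  have ha : ∀ j, ‖a j‖ ^ 2 = ∑ i, ‖A i j‖ ^ 2 := fun j => by
    rw [EuclideanSpace.norm_sq_eq]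
    rfl
  have hw : ∀ j, colProb A j = ‖a j‖ ^ 2 / frobSq A := fun j => by rw [ha]; rfl
  have hw0 : ∀ j, 0 ≤ colProb A j := fun j => by
    rw [hw]
    positivity
  have hw1 : ∑ j, colProb A j = 1 := by
    simp only [colProb]
    rw [← Finset.sum_div, Finset.sum_comm]
    exact div_self hF.ne'
  have hset : {J : Fin d → Fin n | ∃ X : Matrix (Fin d) (Fin n) 𝕜, A = A.submatrix id J * X} =
      {J | ∀ j, a j ∈ Submodule.span 𝕜 (Set.range (a ∘ J))} := by
    ext J
    rw [Set.mem_ofPred_eq, exists_eq_cols_mul_iff]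
    refine forall_congr' fun j => ?_
    let e := (WithLp.linearEquiv 2 𝕜 (Fin m → 𝕜)).symm
    have : Set.range (a ∘ J) = e '' (A.col '' Set.range J) := by
      rw [← Set.range_comp, ← Set.range_comp]
      rfl
    rw [this, ← LinearEquiv.coe_coe, Submodule.span_image]
    exact (Submodule.mem_map_equiv _ (e := e) (x := a j)).symm
  rw [hset]
  set F := Submodule.span 𝕜 (Set.range a) with hFdef
  have hinner : ∀ u ∈ F, ‖u‖ ^ 2 ≤ s ^ 2 * ∑ j, ‖inner 𝕜 u (a j)‖ ^ 2 := by
    intro u hu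
    obtain ⟨v, rfl⟩ : ∃ v : Fin n → 𝕜, WithLp.toLp 2 (A *ᵥ v) = u := by
      obtain ⟨v, rfl⟩ := Submodule.mem_span_range_iff_exists_fun 𝕜 |>.mp hu
      refine ⟨v, ?_⟩
      ext i
      simp [a, Matrix.mulVec, dotProduct, mul_comm]
    refine (h v).trans_eq ?_
    rw [EuclideanSpace.norm_sq_eq]
    congr 1
    refine Finset.sum_congr rfl fun j _ => ?_
    rw [← norm_inner_symm]
    congr 2
    simp [a, PiLp.inner_apply, Matrix.mulVec, dotProduct, mul_comm]
  have hcod : ∀ V ≤ F, ((Module.finrank 𝕜 F : ℝ) - Module.finrank 𝕜 V) *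
      (s ^ 2 * frobSq A)⁻¹ ≤ ∑ j, if a j ∈ V then 0 else colProb A j := by
    intro V hV
    have h1 := codim_mul_le_sum_sq_notMem a hinner V hV
    have h2 : ∑ j, (if a j ∈ V then 0 else colProb A j) =
        (∑ j, if a j ∈ V then 0 else ‖a j‖ ^ 2) / frobSq A := by
      rw [Finset.sum_div]
      refine Finset.sum_congr rfl fun j _ => ?_
      split_ifs
      · simp
      · exact hw j
    rw [h2, ← div_eq_mul_inv, div_le_div_iff₀ (by positivity) hF]
    nlinarith
  have hk1 : 1 ≤ Module.finrank 𝕜 F := by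
    refine Submodule.one_le_finrank_iff.mpr fun h0 => hA ?_
    ext i j
    have : a j ∈ F := Submodule.subset_span ⟨j, rfl⟩
    rw [h0, Submodule.mem_bot] at this
    exact congrArg (fun v : EuclideanSpace 𝕜 (Fin m) => v i) this
  -- The case `V = ⊥` of the codimension bound, since the total weight is one.
  have hkμ : (Module.finrank 𝕜 F : ℝ) * (s ^ 2 * frobSq A)⁻¹ ≤ 1 := by
    have h1 := hcod ⊥ bot_le
    rw [finrank_bot, Nat.cast_zero, sub_zero] at h1
    refine h1.trans (hw1 ▸ Finset.sum_le_sum fun j _ => ?_)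
    split_ifs
    · exact hw0 j
    · exact le_rfl
  have hμ0 : 0 < (s ^ 2 * frobSq A)⁻¹ := by positivity
  have hk1' : (1 : ℝ) ≤ Module.finrank 𝕜 F := by exact_mod_cast hk1
  rcases hk1.lt_or_eq with hk2 | hk2
  · have h1 := le_pi_real_spanning a (colProb A) hw0 hw1 (by nlinarith) hcod d
    have h2 := mul_one_sub_pow_le hk2 hμ0 hkμ (by
      rw [hr]
      exact inv_mul_cancel₀ (by positivity)) hκ hδ hδ1 hε hεκ hd
    linarith
  -- Rank one: zero columns have weight zero, so `μ = 1` is admissible and, as `d ≥ 1`, failure has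
  -- probability zero.
  · have h1 := le_pi_real_spanning a (colProb A) hw0 hw1 le_rfl (fun V hV => by
      rw [← hk2]
      rcases Nat.eq_zero_or_pos (Module.finrank 𝕜 V) with h0 | h0
      · rw [Submodule.finrank_eq_zero.mp h0, finrank_bot]
        simp only [Nat.cast_one, Nat.cast_zero, sub_zero, mul_one]
        refine (hw1 ▸ Finset.sum_le_sum fun j _ => ?_)
        split_ifs with hj
        · rw [hw, (Submodule.mem_bot 𝕜).mp hj]
          simp
        · exact le_rfl
      · have h3 : (1 : ℝ) ≤ Module.finrank 𝕜 V := by exact_mod_cast h0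
        have h4 : 0 ≤ ∑ j, if a j ∈ V then 0 else colProb A j :=
          Finset.sum_nonneg fun j _ => by
            split_ifs
            · exact le_rfl
            · exact hw0 j
        push_cast
        linarith) d
    rw [sub_self, zero_pow (by omega), mul_zero, sub_zero] at h1
    linarith [Real.exp_pos (-1 / δ)]

end SubspaceCUR

/-! ### Assembly: rows and columns sampled together -/

theorem mainTheorem9 :
    ∃ C > (0 : ℝ), ∃ c > (0 : ℝ), ∀ (𝕜 : Type) [RCLike 𝕜] (m n l : ℕ)
      (A : Matrix (Fin m) (Fin n) 𝕜) (S : Fin l → Submodule 𝕜 (Fin m → 𝕜)),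
      -- the columns come from a union of independent subspaces, with generic data on each
      (∀ j, ∃ i, A.col j ∈ S i) →
      SubspaceCUR.IndependentSubspaces S →
      (∀ i, SubspaceCUR.IsGeneric (S i) (SubspaceCUR.dataIn A (S i))) →
      (∀ i, 2 ≤ Module.finrank 𝕜 (S i) →
        Module.finrank 𝕜 (S i) < (SubspaceCUR.dataIn A (S i)).ncard) →
      -- the sampling parameters
      ∀ δ ε : ℝ, 0 < δ → δ < 1 → 0 < ε → ε < (SubspaceCUR.condNumber A)⁻¹ →
      ∀ d₁ ∈ Finset.Icc 1 m, ∀ d₂ ∈ Finset.Icc 1 n,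
      C * (SubspaceCUR.stableRank A / (ε ^ 4 * δ) *
        Real.log (SubspaceCUR.stableRank A / (ε ^ 4 * δ))) ≤ d₁ →
      C * (SubspaceCUR.stableRank A / (ε ^ 4 * δ) *
        Real.log (SubspaceCUR.stableRank A / (ε ^ 4 * δ))) ≤ d₂ →
      -- both for the sampled indices and for the sampled indices without repetitions
      (1 - 2 * Real.exp (-c / δ)) ^ 2 ≤ (SubspaceCUR.samplingLaw A d₁ d₂).real
        {IJ | SubspaceCUR.CURClusters A S IJ.1 IJ.2 ∧
          SubspaceCUR.CURClusters A S (Subtype.val : Set.range IJ.1 → Fin m)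
            (Subtype.val : Set.range IJ.2 → Fin n)} := by
  refine ⟨3, by norm_num, 1, one_pos, ?_⟩
  intro 𝕜 _ m n l A S hcol hS hgen hcard δ ε hδ hδ1 hε hεκ d₁ hd₁ d₂ hd₂ hC₁ hC₂
  -- With `0⁻¹ = 0`, the bounds on `ε` exclude a vanishing condition number, and hence `A = 0`.
  have hκ0 : 0 < SubspaceCUR.condNumber A := inv_pos.mp (hε.trans hεκ)
  have hκ := SubspaceCUR.one_le_condNumber hκ0
  have hσ : 0 < SubspaceCUR.specNorm A := pos_of_mul_pos_left hκ0 (SubspaceCUR.specNorm_nonneg _)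
  have hs : 0 < SubspaceCUR.specNorm (SubspaceCUR.pinv A) := pos_of_mul_pos_right hκ0 (SubspaceCUR.specNorm_nonneg _)
  have hA : A ≠ 0 := by
    rintro rfl
    simp [SubspaceCUR.specNorm] at hσ
  have hr : SubspaceCUR.stableRank A * SubspaceCUR.condNumber A ^ 2 = SubspaceCUR.specNorm (SubspaceCUR.pinv A) ^ 2 * SubspaceCUR.frobSq A := by
    rw [SubspaceCUR.stableRank, SubspaceCUR.condNumber]
    field_simp
  have hMP := SubspaceCUR.isMoorePenrose_pinv A
  have hJ := SubspaceCUR.le_pi_real_exists_eq_cols_mul hA hs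
    (fun v => SubspaceCUR.norm_sq_toLp_le_of_mem_range A (A *ᵥ v) (by
      rw [Matrix.mulVec_mulVec, Matrix.mulVec_mulVec, hMP.mul_mul_self]))
    hr hκ hδ hδ1 hε hεκ (Finset.mem_Icc.mp hd₂).1 hC₂
  have hI := SubspaceCUR.le_pi_real_exists_eq_cols_mul (A := Aᴴ)
    (fun h => hA (Matrix.conjTranspose_eq_zero.mp h)) hs
    -- Here `A†A` fixes the range of `Aᴴ`, so `‖A†‖₂` serves for the rows as well.
    (fun v => by
      have h1 := SubspaceCUR.norm_mulVec_le_specNorm (SubspaceCUR.pinv A) (A *ᵥ (Aᴴ *ᵥ v))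
      have h2 : SubspaceCUR.pinv A *ᵥ (A *ᵥ (Aᴴ *ᵥ v)) = Aᴴ *ᵥ v := by
        have h3 := congrArg Matrix.conjTranspose hMP.mul_mul_self
        rw [Matrix.mul_assoc, Matrix.conjTranspose_mul, hMP.isHermitian_right.eq] at h3
        rw [Matrix.mulVec_mulVec, Matrix.mulVec_mulVec, h3]
      rw [h2] at h1
      rw [Matrix.conjTranspose_conjTranspose, ← mul_pow]
      exact pow_le_pow_left₀ (norm_nonneg _) h1 2)
    (by rw [SubspaceCUR.frobSq_conjTranspose]; exact hr) hκ hδ hδ1 hε hεκ (Finset.mem_Icc.mp hd₁).1 hC₁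
  rw [SubspaceCUR.colProb_conjTranspose] at hI
  have := SubspaceCUR.isProbabilityMeasure_samplingLaw A hA d₁ d₂
  have hsub : {I : Fin d₁ → Fin m | ∃ X : Matrix (Fin d₁) (Fin m) 𝕜,
        Aᴴ = Aᴴ.submatrix id I * X} ×ˢ
      {J : Fin d₂ → Fin n | ∃ X : Matrix (Fin d₂) (Fin n) 𝕜, A = A.submatrix id J * X} ⊆
      {IJ | SubspaceCUR.CURClusters A S IJ.1 IJ.2 ∧
          SubspaceCUR.CURClusters A S (Subtype.val : Set.range IJ.1 → Fin m)
            (Subtype.val : Set.range IJ.2 → Fin n)} := by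
    rintro ⟨I, J⟩ ⟨hI, hJ⟩
    have key : ∀ (α β : Type) [Fintype α] [Fintype β] (I' : α → Fin m) (J' : β → Fin n),
        Set.range I' = Set.range I → Set.range J' = Set.range J → SubspaceCUR.CURClusters A S I' J' := by
      intro α β _ _ I' J' hI' hJ'
      rw [Set.mem_ofPred_eq, SubspaceCUR.exists_eq_cols_mul_iff, ← hI', ← SubspaceCUR.exists_eq_cols_mul_iff] at hI
      rw [Set.mem_ofPred_eq, SubspaceCUR.exists_eq_cols_mul_iff, ← hJ', ← SubspaceCUR.exists_eq_cols_mul_iff] at hJ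
      obtain ⟨W, hW⟩ := hI
      obtain ⟨X, hX⟩ := hJ
      refine SubspaceCUR.curClusters_of_factor (W := Wᴴ) hA hcol hS hgen hcard hX ?_
      have := congrArg Matrix.conjTranspose hW
      rwa [Matrix.conjTranspose_mul, Matrix.conjTranspose_submatrix,
        Matrix.conjTranspose_conjTranspose] at this
    exact ⟨key _ _ I J rfl rfl, key _ _ _ _ Subtype.range_val Subtype.range_val⟩
  refine le_trans ?_ (measureReal_mono hsub)
  rw [SubspaceCUR.samplingLaw, measureReal_prod_prod, sq]
  -- Multiplying the two lower bounds needs a nonnegative factor; `δ < 1` and `e ≥ 2` give it.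
  have h0 : 0 ≤ 1 - 2 * Real.exp (-1 / δ) := by
    have h1 : Real.exp (-1 / δ) ≤ Real.exp (-1) := by
      refine Real.exp_le_exp.mpr ?_
      rw [div_le_iff₀ hδ]
      linarith
    have h2 : Real.exp (-1) ≤ 2⁻¹ := by
      rw [Real.exp_neg]
      exact inv_anti₀ (by norm_num) (by linarith [Real.add_one_le_exp (1 : ℝ)])
    linarith
  exact mul_le_mul hI hJ h0 measureReal_nonneg
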